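/- **Notation.** Let $t\ge 1$. For a probability measure $\nu$ on a unitary group (a unitary ensemble), its $t$-th moment operator is $T_t^{\nu}=\int U^{\otimes t}\otimes \bar U^{\otimes t}\,d\nu(U)$; for the Haar probability measure on $\mathrm U(4)$ it is denoted $T_t^{\mathrm U(4)}$. A gate $U\in \mathrm U(4)$ has KAK coefficients $(k_x,k_y,k_z)\in\mathbb R^3$ if $U=(A_1\otimes A_2)\exp[i(k_xX\otimes X+k_yY\otimes Y+k_zZ\otimes Z)](B_1\otimes B_2)$ for some $A_1,A_2,B_1,B_2\in \mathrm U(2)$, where $X,Y,Z$ are the Pauli matrices. The (ironed) gadget of a two-qubit gate $U\in\mathrm U(4)$ is the law of $(A_1\otimes A_2)\,U\,(B_1\otimes B_2)$ for independent Haar-random $A_1,A_2,B_1,B_2\in\mathrm U(2)$; the symmetrized gadget is the same with $U$ replaced by $U$ or $U^\dagger$, each with probability $1/2$. For two distinct sites $i,j$ among $n$ qubits, $U_{i,j}$ denotes the gate $U\in\mathrm U(4)$ acting on qubits $i,j$ and as the identity on the other qubits. For an ensemble $\nu$ on $\mathrm U(4)$, $\mathsf T_{t,(i,j)}^{\nu}$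 denotes the $t$-th moment operator of the law of $U_{i,j}$, $U\sim\nu$, on the $n$-qubit system; when $\nu$ is Haar it is denoted $\mathsf T_{t,(i,j)}^{\mathrm U(4)}$. **Theorem.** Let $t\ge 4$. 1. There are no KAK coefficients that give an exact $t$-design: for all $(k_x,k_y,k_z)\in\mathbb R^3$ and every $U\in\mathrm U(4)$ with these KAK coefficients, $T_t^{\mathrm{Gadget}(U)}\ne T_t^{\mathrm U(4)}$, both for the gadget and for the symmetrized gadget of $U$. 2. Consequently, for every $n$, every pair of distinct sites $i\neq j$ of an $n$-qubit system and every two-qubit gate $U\in\mathrm U(4)$, $\mathsf T_{t,(i,j)}^{\mathrm{Gadget}(U)}\neq \mathsf T_{t,(i,j)}^{\mathrm U(4)}$, again both for the gadget and for the symmetrized gadget of $U$. -/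

import Mathlib

open MeasureTheory
open scoped Kronecker ENNReal Matrix

namespace IronedGadget

/-- The unitary group `U(ι)`: unitary complex matrices with rows and columns indexed by `ι`. -/
abbrev UGroup (ι : Type) [Fintype ι] [DecidableEq ι] : Type :=
  Matrix.unitaryGroup ι ℂ

/-- The unitary group carries its Borel σ-algebra. -/
noncomputable instance instMeasurableSpaceUGroup (ι : Type) [Fintype ι] [DecidableEq ι] :
    MeasurableSpace (UGroup ι) := borel _

instance instBorelSpaceUGroup (ι : Type) [Fintype ι] [DecidableEq ι] :
    BorelSpace (UGroup ι) := ⟨rfl⟩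

instance instCompactSpaceUGroup (ι : Type) [Fintype ι] [DecidableEq ι] :
    CompactSpace (UGroup ι) := by
  have hK : IsCompact (Set.univ.pi fun _ : ι => Set.univ.pi fun _ : ι =>
      Metric.closedBall (0 : ℂ) 1) :=
    isCompact_univ_pi fun _ => isCompact_univ_pi fun _ => isCompact_closedBall _ _
  have hc : IsClosed {A : Matrix ι ι ℂ | A * star A = 1} :=
    isClosed_eq (by fun_prop) continuous_const
  have h : IsCompact (Matrix.unitaryGroup ι ℂ : Set (Matrix ι ι ℂ)) := by
    refine IsCompact.of_isClosed_subset (X := Matrix ι ι ℂ) hK ?_ ?_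
    · convert hc using 1
      ext A
      exact Matrix.mem_unitaryGroup_iff
    · intro A hA i _ j _
      rw [mem_closedBall_zero_iff]
      exact entry_norm_bound_of_unitary hA i j
  exact isCompact_iff_compactSpace.mp h

/-- The Haar probability measure on the unitary group. -/
noncomputable def haarU (ι : Type) [Fintype ι] [DecidableEq ι] : Measure (UGroup ι) :=
  Measure.haarMeasure ⊤

/-- The `t`-fold tensor power `A^{⊗ t}`, in the product basis. -/
def tensorPow {ι : Type} (t : ℕ) (A : Matrix ι ι ℂ) : Matrix (Fin t → ι) (Fin t → ι) ℂ :=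
  Matrix.of fun a b => ∏ s, A (a s) (b s)

/-- The `t`-th moment operator `∫ U^{⊗ t} ⊗ Ū^{⊗ t} dν(U)` of a unitary ensemble `ν`
(a probability measure on the unitary group), as a matrix integrated entry by entry. -/
noncomputable def momentOperator {ι : Type} [Fintype ι] [DecidableEq ι] (t : ℕ)
    (ν : Measure (UGroup ι)) :
    Matrix ((Fin t → ι) × (Fin t → ι)) ((Fin t → ι) × (Fin t → ι)) ℂ :=
  Matrix.of fun p q =>
    ∫ U, (tensorPow t (U : Matrix ι ι ℂ) ⊗ₖ tensorPow t ((U : Matrix ι ι ℂ).map star)) p q ∂ν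

/-- The index set of the computational basis of two qubits, so that `UGroup TwoQubits = U(4)`. -/
abbrev TwoQubits : Type := Fin 2 × Fin 2

/-- `A₁ ⊗ A₂` as a two-qubit gate. -/
def localGate (A₁ A₂ : UGroup (Fin 2)) : UGroup TwoQubits :=
  ⟨(A₁ : Matrix (Fin 2) (Fin 2) ℂ) ⊗ₖ (A₂ : Matrix (Fin 2) (Fin 2) ℂ),
    Matrix.kronecker_mem_unitary A₁.2 A₂.2⟩

/-- The Pauli matrix `X`. -/
def pauliX : Matrix (Fin 2) (Fin 2) ℂ := !![0, 1; 1, 0]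

/-- The Pauli matrix `Y`. -/
def pauliY : Matrix (Fin 2) (Fin 2) ℂ := !![0, -Complex.I; Complex.I, 0]

/-- The Pauli matrix `Z`. -/
def pauliZ : Matrix (Fin 2) (Fin 2) ℂ := !![1, 0; 0, -1]

/-- `exp[i (k_x X ⊗ X + k_y Y ⊗ Y + k_z Z ⊗ Z)]` as a matrix. -/
noncomputable def kakMatrix (kx ky kz : ℝ) : Matrix TwoQubits TwoQubits ℂ :=
  NormedSpace.exp (Complex.I • ((kx : ℂ) • (pauliX ⊗ₖ pauliX) + (ky : ℂ) • (pauliY ⊗ₖ pauliY)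
    + (kz : ℂ) • (pauliZ ⊗ₖ pauliZ)))

/-- `U` has KAK coefficients `(k_x, k_y, k_z)`: it is
`(A₁ ⊗ A₂) exp[i (k_x X ⊗ X + k_y Y ⊗ Y + k_z Z ⊗ Z)] (B₁ ⊗ B₂)` for some `Aᵢ, Bᵢ ∈ U(2)`. -/
def HasKAKCoefficients (U : UGroup TwoQubits) (kx ky kz : ℝ) : Prop :=
  ∃ A₁ A₂ B₁ B₂ : UGroup (Fin 2),
    (U : Matrix TwoQubits TwoQubits ℂ) =
      (localGate A₁ A₂ : Matrix TwoQubits TwoQubits ℂ) * kakMatrix kx ky kz *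
        (localGate B₁ B₂ : Matrix TwoQubits TwoQubits ℂ)

/-- The ironed gadget of a two-qubit gate `U`: the law of `(A₁ ⊗ A₂) U (B₁ ⊗ B₂)` for independent
Haar-random single-qubit gates `A₁, A₂, B₁, B₂`. -/
noncomputable def gadget (U : UGroup TwoQubits) : Measure (UGroup TwoQubits) :=
  (((haarU (Fin 2)).prod (haarU (Fin 2))).prod ((haarU (Fin 2)).prod (haarU (Fin 2)))).map
    fun g => localGate g.1.1 g.1.2 * U * localGate g.2.1 g.2.2

/-- The symmetrized ironed gadget: the fixed gate is `U` or `U⁻¹ = U†`, with probability `1/2`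
each. -/
noncomputable def symmGadget (U : UGroup TwoQubits) : Measure (UGroup TwoQubits) :=
  (2⁻¹ : ℝ≥0∞) • (gadget U + gadget U⁻¹)

/-- The matrix on `n` qubits of a two-qubit matrix acting on the `i`-th and the `j`-th qubit and
as the identity on all others. -/
def onSitesMatrix {n : ℕ} (i j : Fin n) (A : Matrix TwoQubits TwoQubits ℂ) :
    Matrix (Fin n → Fin 2) (Fin n → Fin 2) ℂ :=
  Matrix.of fun a b =>
    if ∀ k, k ≠ i → k ≠ j → a k = b k then A (a i, a j) (b i, b j) else 0

theorem onSitesMatrix_mul {n : ℕ} {i j : Fin n} (hij : i ≠ j)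
    (A B : Matrix TwoQubits TwoQubits ℂ) :
    onSitesMatrix i j A * onSitesMatrix i j B = onSitesMatrix i j (A * B) := by
  ext a b
  have hji : j ≠ i := hij.symm
  simp only [onSitesMatrix, Matrix.mul_apply, Matrix.of_apply]
  by_cases hab : ∀ k, k ≠ i → k ≠ j → a k = b k
  · rw [if_pos hab]
    have h1 : ∀ c : Fin n → Fin 2,
        ((if ∀ k, k ≠ i → k ≠ j → a k = c k then A (a i, a j) (c i, c j) else 0) *
          if ∀ k, k ≠ i → k ≠ j → c k = b k then B (c i, c j) (b i, b j) else 0) =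
        if ∀ k, k ≠ i → k ≠ j → a k = c k then
          A (a i, a j) (c i, c j) * B (c i, c j) (b i, b j) else 0 := by
      intro c
      by_cases hc : ∀ k, k ≠ i → k ≠ j → a k = c k
      · rw [if_pos hc, if_pos hc, if_pos fun k hi hj => (hc k hi hj).symm.trans (hab k hi hj)]
      · rw [if_neg hc, if_neg hc, zero_mul]
    rw [Finset.sum_congr rfl fun c _ => h1 c, ← Finset.sum_filter]
    refine Finset.sum_nbij' (fun c => (c i, c j))
      (fun p => Function.update (Function.update a i p.1) j p.2) ?_ ?_ ?_ ?_ ?_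
    · intro c _
      exact Finset.mem_univ _
    · intro p _
      rw [Finset.mem_filter]
      refine ⟨Finset.mem_univ _, fun k hi hj => ?_⟩
      rw [Function.update_of_ne hj, Function.update_of_ne hi]
    · intro c hc
      have hc' := (Finset.mem_filter.mp hc).2
      funext k
      by_cases hj : k = j
      · subst hj
        simp
      · by_cases hi : k = i
        · subst hi
          simp [hij]
        · simp [hi, hj, hc' k hi hj]
    · intro p _
      simp [hij]
    · intro c _
      rfl
  · rw [if_neg hab]
    refine Finset.sum_eq_zero fun c _ => ?_
    by_cases hc : ∀ k, k ≠ i → k ≠ j → a k = c k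
    · have hcb : ¬ ∀ k, k ≠ i → k ≠ j → c k = b k := fun h =>
        hab fun k hi hj => (hc k hi hj).trans (h k hi hj)
      rw [if_neg hcb, mul_zero]
    · rw [if_neg hc, zero_mul]

theorem onSitesMatrix_one {n : ℕ} (i j : Fin n) :
    onSitesMatrix i j (1 : Matrix TwoQubits TwoQubits ℂ) = 1 := by
  ext a b
  simp only [onSitesMatrix, Matrix.of_apply, Matrix.one_apply, Prod.mk.injEq]
  by_cases hab : a = b
  · simp [hab]
  · rw [if_neg hab]
    split_ifs with h1 h2
    · refine absurd (funext fun k => ?_) hab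
      by_cases hi : k = i
      · rw [hi, h2.1]
      · by_cases hj : k = j
        · rw [hj, h2.2]
        · exact h1 k hi hj
    · rfl
    · rfl

theorem onSitesMatrix_star {n : ℕ} (i j : Fin n) (A : Matrix TwoQubits TwoQubits ℂ) :
    star (onSitesMatrix i j A) = onSitesMatrix i j (star A) := by
  ext a b
  simp only [onSitesMatrix, Matrix.star_apply, Matrix.of_apply, apply_ite star, star_zero]
  simp only [eq_comm]

/-- The two-qubit gate `U` applied to the `i`-th and the `j`-th of `n` qubits. -/
def onSites {n : ℕ} (i j : Fin n) (hij : i ≠ j) (U : UGroup TwoQubits) :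
    UGroup (Fin n → Fin 2) :=
  ⟨onSitesMatrix i j (U : Matrix TwoQubits TwoQubits ℂ), by
    rw [Matrix.mem_unitaryGroup_iff, onSitesMatrix_star, onSitesMatrix_mul hij,
      Matrix.mem_unitaryGroup_iff.mp U.2, onSitesMatrix_one]⟩

end IronedGadget

/-!
The obstruction is a single function on `U(4)`. Let `S = J ⊗ J` with `J = iY`, and let
`a(V) = tr (S V S Vᵀ)`, the trace of `M Mᵀ` for the matrix `M` of `V` in the magic basis. Since
`Aᵀ J A = det A • J` for every `2 × 2` matrix `A`, multiplying `V` by local gates on either side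
changes `a(V)` only by a phase, and `a(V†)` is the complex conjugate of `a(V)`. So `|a|²` is almost
surely equal to the constant `c = |a(U)|²` under the gadget of `U`, and also under the symmetrized
gadget (`ae_entanglingTrace_gadget`, `ae_entanglingTrace_symmGadget`).

On the other hand `(|a|² - c)²` is a polynomial of degree `(4, 4)` in the entries of `V` and their
conjugates, so for `t ≥ 4` its mean is determined by the `t`-th moment operator
(`integral_eq_of_momentOperator_eq`); monomials of lower degree are padded to degree `(t, t)` by
means of `∑ₖ V i k * conj (V i k) = 1`. Equality of the moment operators would thus force the Haar
mean of the continuous nonnegative function `(|a|² - c)²` to vanish, so `|a|²` would be constant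
on `U(4)`; but `a(1) = 4`, while `a(CZ) = 0` (`momentOperator_ne_of_ae_const`). The KAK
coefficients play no role: the argument applies to every gate.

For a gate on two sites of an `n`-qubit system, the moment operator of the two-qubit ensemble is
a submatrix of the moment operator of the embedded ensemble
(`momentOperator_eq_of_onSites`), which reduces the second claim to the first.
-/

namespace IronedGadget

/-! ### Topology and measure on the unitary group -/

section Topology

variable {ι : Type} [Fintype ι] [DecidableEq ι]

instance instSecondCountableUGroup : SecondCountableTopology (UGroup ι) :=
  haveI : SecondCountableTopology (Matrix ι ι ℂ) :=
    inferInstanceAs (SecondCountableTopology (ι → ι → ℂ))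
  inferInstanceAs (SecondCountableTopology (Matrix.unitaryGroup ι ℂ : Set (Matrix ι ι ℂ)))

theorem continuous_entry (i j : ι) : Continuous fun U : UGroup ι => (U : Matrix ι ι ℂ) i j :=
  continuous_subtype_val.matrix_elem i j

instance instIsHaarMeasureHaarU : (haarU ι).IsHaarMeasure :=
  Measure.isHaarMeasure_haarMeasure _

theorem integrable_of_continuous (ν : Measure (UGroup ι)) [IsFiniteMeasure ν] {g : UGroup ι → ℂ}
    (hg : Continuous g) : Integrable g ν :=
  hg.integrable_of_hasCompactSupport (HasCompactSupport.of_compactSpace g)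

end Topology

theorem continuous_localGate :
    Continuous fun p : UGroup (Fin 2) × UGroup (Fin 2) => localGate p.1 p.2 := by
  refine Continuous.subtype_mk ?_ _
  refine continuous_matrix fun i j => ?_
  exact ((continuous_entry _ _).comp continuous_fst).mul ((continuous_entry _ _).comp continuous_snd)

theorem continuous_gadgetMap (U : UGroup TwoQubits) :
    Continuous fun g : (UGroup (Fin 2) × UGroup (Fin 2)) × (UGroup (Fin 2) × UGroup (Fin 2)) =>
      localGate g.1.1 g.1.2 * U * localGate g.2.1 g.2.2 :=
  ((continuous_localGate.comp continuous_fst).mul continuous_const).mul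
    (continuous_localGate.comp continuous_snd)

instance instIsFiniteMeasureGadget (U : UGroup TwoQubits) : IsFiniteMeasure (gadget U) := by
  unfold gadget
  infer_instance

instance instIsFiniteMeasureSymmGadget (U : UGroup TwoQubits) :
    IsFiniteMeasure (symmGadget U) := by
  unfold symmGadget
  exact Measure.smul_finite _ (by simp)

theorem continuous_onSites {n : ℕ} (i j : Fin n) (hij : i ≠ j) :
    Continuous (onSites i j hij) := by
  refine Continuous.subtype_mk ?_ _
  refine continuous_matrix fun a b => ?_
  simp only [onSitesMatrix, Matrix.of_apply]
  split_ifs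
  · exact continuous_entry _ _
  · exact continuous_const

/-! ### Balanced polynomials and moment operators -/

section Balanced

variable {ι : Type} [Fintype ι] [DecidableEq ι]

/-- The matrix entry `U ↦ U i j` as a continuous function on the unitary group. -/
noncomputable def entry (i j : ι) : C(UGroup ι, ℂ) := ⟨fun U => (U : Matrix ι ι ℂ) i j, continuous_entry i j⟩

@[simp]
theorem entry_apply (i j : ι) (U : UGroup ι) : entry i j U = (U : Matrix ι ι ℂ) i j := rfl

/-- The monomials `U i j * conj (U k l)` of degree `(1, 1)`. -/
noncomputable def balancedMonomials (ι : Type) [Fintype ι] [DecidableEq ι] : Set C(UGroup ι, ℂ) :=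
  Set.range fun x : (ι × ι) × (ι × ι) => entry x.1.1 x.1.2 * star (entry x.2.1 x.2.2)

/-- The polynomial functions of degree `(1, 1)` in `(U, Ū)`. Its `t`-th power as a submodule of the
algebra of continuous functions consists of the polynomial functions of degree `(t, t)`. -/
noncomputable def balanced (ι : Type) [Fintype ι] [DecidableEq ι] : Submodule ℂ C(UGroup ι, ℂ) :=
  Submodule.span ℂ (balancedMonomials ι)

theorem entry_mul_star_entry_mem (i j k l : ι) :
    entry i j * star (entry k l) ∈ balanced ι :=
  Submodule.subset_span ⟨((i, j), (k, l)), rfl⟩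

/-- The rows of a unitary matrix are unit vectors, so constants are polynomials of
degree `(1, 1)`. -/
theorem one_le_balanced [Nonempty ι] : 1 ≤ balanced ι := by
  rw [Submodule.one_le]
  obtain ⟨i⟩ := ‹Nonempty ι›
  have h : (1 : C(UGroup ι, ℂ)) = ∑ k, entry i k * star (entry i k) := by
    ext U
    have hU := congrFun (congrFun (Matrix.mem_unitaryGroup_iff.mp U.2) i) i
    simp only [Matrix.mul_apply, Matrix.star_apply, Matrix.one_apply_eq] at hU
    simp [ContinuousMap.sum_apply, ← hU]
  rw [h]
  exact Submodule.sum_mem _ fun k _ => entry_mul_star_entry_mem i k i k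

/-- The `t`-th moment operator determines the mean of every polynomial of degree `(t, t)`. -/
theorem integral_eq_of_momentOperator_eq {t : ℕ} {ν μ : Measure (UGroup ι)} [IsFiniteMeasure ν]
    [IsFiniteMeasure μ] (h : momentOperator t ν = momentOperator t μ) {g : C(UGroup ι, ℂ)}
    (hg : g ∈ balanced ι ^ t) : ∫ U, g U ∂ν = ∫ U, g U ∂μ := by
  rw [balanced, Submodule.span_pow] at hg
  induction hg using Submodule.span_induction with
  | mem g hg =>
    obtain ⟨f, rfl⟩ := Set.mem_pow.mp hg
    choose x hx using fun s => (f s).2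
    have hval : ∀ U : UGroup ι, (List.ofFn fun s => (f s : C(UGroup ι, ℂ))).prod U =
        (tensorPow t (U : Matrix ι ι ℂ) ⊗ₖ tensorPow t ((U : Matrix ι ι ℂ).map star))
          (fun s => (x s).1.1, fun s => (x s).2.1) (fun s => (x s).1.2, fun s => (x s).2.2) := by
      intro U
      rw [List.prod_ofFn, ContinuousMap.prod_apply]
      simp [← hx, tensorPow, Finset.prod_mul_distrib]
    simp only [hval]
    exact congrFun (congrFun h (fun s => (x s).1.1, fun s => (x s).2.1))
      (fun s => (x s).1.2, fun s => (x s).2.2)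
  | zero => simp
  | add f g _ _ hf hg =>
    simp only [ContinuousMap.add_apply]
    rw [integral_add (integrable_of_continuous ν f.continuous)
      (integrable_of_continuous ν g.continuous),
      integral_add (integrable_of_continuous μ f.continuous)
      (integrable_of_continuous μ g.continuous), hf, hg]
  | smul c f _ hf =>
    simp only [ContinuousMap.smul_apply]
    rw [integral_smul, integral_smul, hf]

end Balanced

/-! ### The local invariant -/

/-- The real antisymmetric matrix `iY`. -/
def symplecticJ : Matrix (Fin 2) (Fin 2) ℂ := !![0, 1; -1, 0]

/-- The matrix `iY ⊗ iY`. -/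
def spinFlip : Matrix TwoQubits TwoQubits ℂ := symplecticJ ⊗ₖ symplecticJ

/-- The quadratic form `tr (S V S Vᵀ)` with `S = iY ⊗ iY`. Its square, divided by
`16 det V`, is the first Makhlin invariant of the gate `V`. -/
def entanglingTrace (V : Matrix TwoQubits TwoQubits ℂ) : ℂ :=
  (spinFlip * V * spinFlip * Vᵀ).trace

theorem transpose_mul_symplecticJ_mul (A : Matrix (Fin 2) (Fin 2) ℂ) :
    Aᵀ * symplecticJ * A = A.det • symplecticJ := by
  ext i j
  fin_cases i <;> fin_cases j <;>
    simp [symplecticJ, Matrix.mul_apply, Matrix.det_fin_two, Fin.sum_univ_two] <;> ring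

theorem transpose_mul_spinFlip_mul (A B : Matrix (Fin 2) (Fin 2) ℂ) :
    (A ⊗ₖ B)ᵀ * spinFlip * (A ⊗ₖ B) = (A.det * B.det) • spinFlip := by
  rw [spinFlip, ← Matrix.kroneckerMap_transpose, ← Matrix.mul_kronecker_mul,
    ← Matrix.mul_kronecker_mul, transpose_mul_symplecticJ_mul, transpose_mul_symplecticJ_mul,
    Matrix.smul_kronecker, Matrix.kronecker_smul, smul_smul]

theorem mul_spinFlip_mul_transpose (A B : Matrix (Fin 2) (Fin 2) ℂ) :
    (A ⊗ₖ B) * spinFlip * (A ⊗ₖ B)ᵀ = (A.det * B.det) • spinFlip := by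
  simpa [← Matrix.kroneckerMap_transpose] using transpose_mul_spinFlip_mul Aᵀ Bᵀ

theorem entanglingTrace_local_mul_mul (A₁ A₂ B₁ B₂ : Matrix (Fin 2) (Fin 2) ℂ)
    (V : Matrix TwoQubits TwoQubits ℂ) :
    entanglingTrace ((A₁ ⊗ₖ A₂) * V * (B₁ ⊗ₖ B₂)) =
      A₁.det * A₂.det * (B₁.det * B₂.det) * entanglingTrace V := by
  have h : entanglingTrace ((A₁ ⊗ₖ A₂) * V * (B₁ ⊗ₖ B₂)) =
      (((A₁ ⊗ₖ A₂)ᵀ * spinFlip * (A₁ ⊗ₖ A₂)) * V *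
        ((B₁ ⊗ₖ B₂) * spinFlip * (B₁ ⊗ₖ B₂)ᵀ) * Vᵀ).trace := by
    rw [entanglingTrace, Matrix.transpose_mul, Matrix.transpose_mul, ← Matrix.mul_assoc,
      ← Matrix.mul_assoc, Matrix.trace_mul_comm]
    simp only [Matrix.mul_assoc]
  rw [h, transpose_mul_spinFlip_mul, mul_spinFlip_mul_transpose]
  simp only [Matrix.smul_mul, Matrix.mul_smul, Matrix.trace_smul, smul_eq_mul, entanglingTrace]
  ring

theorem star_spinFlip : star spinFlip = spinFlip := by
  ext ⟨i, i'⟩ ⟨j, j'⟩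
  fin_cases i <;> fin_cases i' <;> fin_cases j <;> fin_cases j' <;>
    simp [spinFlip, symplecticJ, Matrix.star_apply]

theorem entanglingTrace_star (V : Matrix TwoQubits TwoQubits ℂ) :
    entanglingTrace (star V) = star (entanglingTrace V) := by
  rw [entanglingTrace, entanglingTrace, ← Matrix.trace_conjTranspose]
  have hS : spinFlipᴴ = spinFlip := star_spinFlip
  simp only [Matrix.conjTranspose_mul, hS, Matrix.star_eq_conjTranspose]
  rw [Matrix.trace_mul_comm, Matrix.mul_assoc]
  rfl

theorem norm_entanglingTrace_local_mul_mul (A₁ A₂ B₁ B₂ : UGroup (Fin 2))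
    (U : UGroup TwoQubits) :
    ‖entanglingTrace ((localGate A₁ A₂ * U * localGate B₁ B₂ : UGroup TwoQubits) :
      Matrix TwoQubits TwoQubits ℂ)‖ = ‖entanglingTrace (U : Matrix TwoQubits TwoQubits ℂ)‖ := by
  have hdet : ∀ A : UGroup (Fin 2), ‖(A : Matrix (Fin 2) (Fin 2) ℂ).det‖ = 1 := fun A =>
    CStarRing.norm_of_mem_unitary (Matrix.det_of_mem_unitary A.2)
  rw [Matrix.UnitaryGroup.mul_val, Matrix.UnitaryGroup.mul_val, localGate, localGate,
    entanglingTrace_local_mul_mul]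
  simp [hdet]

theorem norm_entanglingTrace_inv (U : UGroup TwoQubits) :
    ‖entanglingTrace ((U⁻¹ : UGroup TwoQubits) : Matrix TwoQubits TwoQubits ℂ)‖ =
      ‖entanglingTrace (U : Matrix TwoQubits TwoQubits ℂ)‖ := by
  rw [Matrix.UnitaryGroup.inv_val, entanglingTrace_star, norm_star]

theorem continuous_entanglingTrace :
    Continuous fun V : UGroup TwoQubits => entanglingTrace (V : Matrix TwoQubits TwoQubits ℂ) := by
  unfold entanglingTrace
  have h : Continuous fun V : UGroup TwoQubits => (V : Matrix TwoQubits TwoQubits ℂ) :=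
    continuous_subtype_val
  fun_prop

/-- Local gates change the invariant only by determinants of unitary matrices, so its modulus is
almost surely constant under the gadget. -/
theorem ae_entanglingTrace_gadget (U : UGroup TwoQubits) :
    ∀ᵐ V : UGroup TwoQubits ∂gadget U, ‖entanglingTrace (V : Matrix TwoQubits TwoQubits ℂ)‖ =
      ‖entanglingTrace (U : Matrix TwoQubits TwoQubits ℂ)‖ := by
  rw [gadget, ae_map_iff (continuous_gadgetMap U).measurable.aemeasurable
    (isClosed_eq continuous_entanglingTrace.norm continuous_const).measurableSet]
  exact Filter.Eventually.of_forall fun g => norm_entanglingTrace_local_mul_mul _ _ _ _ U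

theorem ae_entanglingTrace_symmGadget (U : UGroup TwoQubits) :
    ∀ᵐ V : UGroup TwoQubits ∂symmGadget U, ‖entanglingTrace (V : Matrix TwoQubits TwoQubits ℂ)‖ =
      ‖entanglingTrace (U : Matrix TwoQubits TwoQubits ℂ)‖ := by
  refine Measure.ae_smul_measure ?_ _
  rw [ae_add_measure_iff]
  refine ⟨ae_entanglingTrace_gadget U, ?_⟩
  have h := ae_entanglingTrace_gadget U⁻¹
  rwa [norm_entanglingTrace_inv] at h

/-! ### Separating the gadget from the Haar measure -/

/-- The local invariant as a continuous function on `U(4)`. -/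
def entanglingTraceMap : C(UGroup TwoQubits, ℂ) :=
  ⟨fun V => entanglingTrace (V : Matrix TwoQubits TwoQubits ℂ), continuous_entanglingTrace⟩

theorem entanglingTraceMap_eq_sum :
    entanglingTraceMap = ∑ a, ∑ d, ∑ c, ∑ b,
      (spinFlip a b * spinFlip c d) • (entry b c * entry a d) := by
  ext V
  simp only [entanglingTraceMap, ContinuousMap.coe_mk, entanglingTrace, Matrix.trace,
    Matrix.diag_apply, Matrix.mul_apply, Matrix.transpose_apply, ContinuousMap.sum_apply,
    ContinuousMap.smul_apply, ContinuousMap.mul_apply, entry_apply, smul_eq_mul, Finset.sum_mul]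
  refine Finset.sum_congr rfl fun a _ => Finset.sum_congr rfl fun d _ =>
    Finset.sum_congr rfl fun c _ => Finset.sum_congr rfl fun b _ => ?_
  ring

/-- Since `a` is a quadratic form in the entries, `|a|²` has degree `(2, 2)`. -/
theorem entanglingTraceMap_mul_star_mem :
    entanglingTraceMap * star entanglingTraceMap ∈ balanced TwoQubits ^ 2 := by
  have key : ∀ a b c d a' b' c' d' : TwoQubits,
      (entry b c * entry a d) * star (entry b' c' * entry a' d') ∈ balanced TwoQubits ^ 2 := by
    intro a b c d a' b' c' d'
    rw [star_mul', mul_mul_mul_comm, pow_two]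
    exact Submodule.mul_mem_mul (entry_mul_star_entry_mem _ _ _ _)
      (entry_mul_star_entry_mem _ _ _ _)
  rw [entanglingTraceMap_eq_sum]
  simp only [star_sum, star_smul, Finset.sum_mul, Finset.mul_sum, smul_mul_smul_comm]
  repeat refine Submodule.sum_mem _ fun _ _ => ?_
  exact Submodule.smul_mem _ _ (key _ _ _ _ _ _ _ _)

/-- The controlled-`Z` gate. -/
def controlledZ : UGroup TwoQubits :=
  ⟨Matrix.diagonal fun p => if p = (1, 1) then -1 else 1, by
    rw [Matrix.mem_unitaryGroup_iff, Matrix.star_eq_conjTranspose,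
      Matrix.diagonal_conjTranspose, Matrix.diagonal_mul_diagonal, ← Matrix.diagonal_one]
    congr 1
    funext p
    by_cases hp : p = (1, 1) <;> simp [hp]⟩

theorem entanglingTrace_diagonal (d : TwoQubits → ℂ) :
    entanglingTrace (Matrix.diagonal d) = 2 * (d (0, 0) * d (1, 1) + d (0, 1) * d (1, 0)) := by
  simp [entanglingTrace, Matrix.trace, Matrix.mul_apply, Fintype.sum_prod_type,
    Fin.sum_univ_two, spinFlip, symplecticJ, Matrix.diagonal_apply]
  ring

theorem entanglingTrace_controlledZ :
    entanglingTrace (controlledZ : Matrix TwoQubits TwoQubits ℂ) = 0 := by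
  rw [controlledZ, entanglingTrace_diagonal]
  simp

theorem entanglingTrace_one :
    entanglingTrace ((1 : UGroup TwoQubits) : Matrix TwoQubits TwoQubits ℂ) = 4 := by
  rw [Matrix.UnitaryGroup.one_val, ← Matrix.diagonal_one, entanglingTrace_diagonal]
  norm_num

/-- An ensemble on which the modulus of the local invariant is almost surely constant is not a
`t`-design for any `t ≥ 4`. -/
theorem momentOperator_ne_of_ae_const {t : ℕ} (ht : 4 ≤ t) (ν : Measure (UGroup TwoQubits))
    [IsFiniteMeasure ν] {r : ℝ}
    (hν : ∀ᵐ V : UGroup TwoQubits ∂ν, ‖entanglingTrace (V : Matrix TwoQubits TwoQubits ℂ)‖ = r) :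
    momentOperator t ν ≠ momentOperator t (haarU TwoQubits) := by
  intro h
  -- The test function is `f = (|a|² - r²)²`; `q ^ 2` is `f` as a complex-valued polynomial.
  let f : UGroup TwoQubits → ℝ := fun V =>
    (‖entanglingTrace (V : Matrix TwoQubits TwoQubits ℂ)‖ ^ 2 - r ^ 2) ^ 2
  let q : C(UGroup TwoQubits, ℂ) :=
    entanglingTraceMap * star entanglingTraceMap - ((r : ℂ) ^ 2) • 1
  have hq : ∀ V, (q ^ 2) V = (f V : ℂ) := by
    intro V
    simp [q, f, entanglingTraceMap, Complex.mul_conj, Complex.normSq_eq_norm_sq]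
  have hone : (1 : C(UGroup TwoQubits, ℂ)) ∈ balanced TwoQubits ^ 2 :=
    by
    simpa using Submodule.pow_mem_pow _
      (Submodule.one_le.mp (one_le_balanced (ι := TwoQubits))) 2
  have hmem : q ^ 2 ∈ balanced TwoQubits ^ t := by
    have hq2 : q ∈ balanced TwoQubits ^ 2 :=
      Submodule.sub_mem _ entanglingTraceMap_mul_star_mem (Submodule.smul_mem _ _ hone)
    have hq4 : q ^ 2 ∈ balanced TwoQubits ^ 4 := by
      have := Submodule.pow_mem_pow _ hq2 2
      rwa [← pow_mul] at this
    -- multiply by `1`, written as a polynomial of degree `(t - 4, t - 4)`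
    rw [← Nat.sub_add_cancel ht, Submodule.pow_add _ (by norm_num)]
    have h1 := Submodule.pow_mem_pow _
      (Submodule.one_le.mp (one_le_balanced (ι := TwoQubits))) (t - 4)
    simpa using Submodule.mul_mem_mul h1 hq4
  have hint := integral_eq_of_momentOperator_eq h hmem
  simp only [hq, integral_complex_ofReal, Complex.ofReal_inj] at hint
  have hzero : ∫ V, f V ∂ν = 0 := by
    refine integral_eq_zero_of_ae ?_
    filter_upwards [hν] with V hV
    simp [f, hV]
  have hf : Continuous f := ((continuous_entanglingTrace.norm.pow 2).sub continuous_const).pow 2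
  have hpos : ∀ V, f V = 0 := by
    by_contra! hne
    obtain ⟨V, hV⟩ := hne
    have := hf.integral_pos_of_hasCompactSupport_nonneg_nonzero (μ := haarU TwoQubits)
      (HasCompactSupport.of_compactSpace f) (fun W => sq_nonneg _) hV
    linarith
  have h1 := hpos 1
  have h2 := hpos controlledZ
  simp only [f, entanglingTrace_one, entanglingTrace_controlledZ, norm_zero, pow_eq_zero_iff,
    ne_eq, OfNat.ofNat_ne_zero, not_false_eq_true] at h1 h2
  norm_num at h1 h2
  rw [h2] at h1
  norm_num at h1

/-! ### Gates on two sites of a larger system -/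

/-- The basis state of `n` qubits with the given values at the sites `i`, `j` and zeros at all
other sites. -/
def extendByZero {n : ℕ} (i j : Fin n) (p : TwoQubits) : Fin n → Fin 2 :=
  Function.update (Function.update 0 i p.1) j p.2

theorem onSites_extendByZero {n : ℕ} {i j : Fin n} (hij : i ≠ j) (U : UGroup TwoQubits)
    (p q : TwoQubits) :
    (onSites i j hij U : Matrix (Fin n → Fin 2) (Fin n → Fin 2) ℂ)
      (extendByZero i j p) (extendByZero i j q) = (U : Matrix TwoQubits TwoQubits ℂ) p q := by
  have h : ∀ k, k ≠ i → k ≠ j → extendByZero i j p k = extendByZero i j q k := by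
    intro k hi hj
    simp [extendByZero, hi, hj]
  simp only [onSites, onSitesMatrix, Matrix.of_apply, if_pos h]
  simp [extendByZero, hij]

/-- Restricting to basis states that vanish away from `i` and `j` recovers the moment operator of
the two-qubit ensemble. -/
theorem momentOperator_map_onSites {n : ℕ} {i j : Fin n} (hij : i ≠ j) (t : ℕ)
    (ν : Measure (UGroup TwoQubits)) (a b c d : Fin t → TwoQubits) :
    momentOperator t (ν.map (onSites i j hij))
      (fun s => extendByZero i j (a s), fun s => extendByZero i j (b s))
      (fun s => extendByZero i j (c s), fun s => extendByZero i j (d s)) =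
    momentOperator t ν (a, b) (c, d) := by
  have hcont : Continuous fun U : UGroup (Fin n → Fin 2) =>
      (tensorPow t (U : Matrix (Fin n → Fin 2) (Fin n → Fin 2) ℂ) ⊗ₖ
        tensorPow t ((U : Matrix (Fin n → Fin 2) (Fin n → Fin 2) ℂ).map star))
        (fun s => extendByZero i j (a s), fun s => extendByZero i j (b s))
        (fun s => extendByZero i j (c s), fun s => extendByZero i j (d s)) := by
    simp only [tensorPow, Matrix.kroneckerMap_apply, Matrix.of_apply, Matrix.map_apply]
    exact (continuous_finsetProd _ fun s _ => continuous_entry _ _).mul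
      (continuous_finsetProd _ fun s _ => (continuous_entry _ _).star)
  simp only [momentOperator, Matrix.of_apply]
  rw [integral_map (continuous_onSites i j hij).measurable.aemeasurable
    hcont.aestronglyMeasurable]
  simp only [tensorPow, Matrix.kroneckerMap_apply, Matrix.of_apply, Matrix.map_apply,
    onSites_extendByZero]

theorem momentOperator_eq_of_onSites {n : ℕ} {i j : Fin n} (hij : i ≠ j) {t : ℕ}
    {ν μ : Measure (UGroup TwoQubits)}
    (h : momentOperator t (ν.map (onSites i j hij)) =
      momentOperator t (μ.map (onSites i j hij))) :
    momentOperator t ν = momentOperator t μ := by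
  ext ⟨a, b⟩ ⟨c, d⟩
  rw [← momentOperator_map_onSites hij, h, momentOperator_map_onSites hij]

end IronedGadget

theorem mainTheorem3 (t : ℕ) (ht : 4 ≤ t) :
    (∀ (kx ky kz : ℝ) (U : IronedGadget.UGroup IronedGadget.TwoQubits),
      IronedGadget.HasKAKCoefficients U kx ky kz →
        IronedGadget.momentOperator t (IronedGadget.gadget U) ≠
            IronedGadget.momentOperator t (IronedGadget.haarU IronedGadget.TwoQubits) ∧
          IronedGadget.momentOperator t (IronedGadget.symmGadget U) ≠
            IronedGadget.momentOperator t (IronedGadget.haarU IronedGadget.TwoQubits)) ∧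
    (∀ (n : ℕ) (i j : Fin n) (hij : i ≠ j) (U : IronedGadget.UGroup IronedGadget.TwoQubits),
        IronedGadget.momentOperator t
              ((IronedGadget.gadget U).map (IronedGadget.onSites i j hij)) ≠
            IronedGadget.momentOperator t
              ((IronedGadget.haarU IronedGadget.TwoQubits).map
                (IronedGadget.onSites i j hij)) ∧
          IronedGadget.momentOperator t
              ((IronedGadget.symmGadget U).map (IronedGadget.onSites i j hij)) ≠
            IronedGadget.momentOperator t
              ((IronedGadget.haarU IronedGadget.TwoQubits).map
                (IronedGadget.onSites i j hij))) := by

  have hg : ∀ U, IronedGadget.momentOperator t (IronedGadget.gadget U) ≠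
      IronedGadget.momentOperator t (IronedGadget.haarU IronedGadget.TwoQubits) := fun U =>
    IronedGadget.momentOperator_ne_of_ae_const ht _ (IronedGadget.ae_entanglingTrace_gadget U)
  have hs : ∀ U, IronedGadget.momentOperator t (IronedGadget.symmGadget U) ≠
      IronedGadget.momentOperator t (IronedGadget.haarU IronedGadget.TwoQubits) := fun U =>
    IronedGadget.momentOperator_ne_of_ae_const ht _ (IronedGadget.ae_entanglingTrace_symmGadget U)
  exact ⟨fun _ _ _ U _ => ⟨hg U, hs U⟩, fun n i j hij U =>
    ⟨fun h => hg U (IronedGadget.momentOperator_eq_of_onSites hij h),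
      fun h => hs U (IronedGadget.momentOperator_eq_of_onSites hij h)⟩⟩
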